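/- Let $\mathsf A$ be a (not necessarily unital) $C^*$-algebra and let $X$ be a right Hilbert $\mathsf A$-module (complete, with inner product $\langle\cdot,\cdot\rangle$ conjugate-linear in the first and $\mathsf A$-linear in the second variable). Write $\mathbb B(X,Y)$ for the adjointable operators between Hilbert $\mathsf A$-modules, $\mathbb B(X)=\mathbb B(X,X)$, $\ell^2(\mathsf A)$ for the Hilbert $\mathsf A$-module of all sequences $(a_n)_{n\in\mathbb N}$ in $\mathsf A$ for which $\sum_n a_n^*a_n$ converges in norm, with $\langle (a_n)_n,(b_n)_n\rangle=\sum_n a_n^*b_n$, and $M(X)=\mathbb B(\mathsf A,X)\supseteq X$ for the multiplier module of $X$ (with $x\in X$ identified with $a\mapsto xa$); for $v\in M(X)$, $a\in\mathsf A$, $x\in X$ put $va=v(a)\in X$, $\langle v,x\rangle=v^*(x)\in\mathsf A$ and $\langle x,v\rangle=\langle v,x\rangle^*$. A sequence $(v_n)_{n\in\mathbb N}$ in $X$ is a frame for $X$ if there are constants $C,D>0$ such that $$C\langle x,x\rangle\le\sum_{n}\langle x,v_n\rangle\langle v_n,x\rangle\le D\langle x,x\rangle\quad\text{for all }x\in X,$$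 where the series converges in norm. A sequence in $M(X)$ with at least one member in $M(X)\setminus X$ that satisfies the same condition is an outer frame for $X$. The analysis operator of a frame or outer frame $(v_n)_n$ is $U\in\mathbb B(X,\ell^2(\mathsf A))$, $Ux=(\langle v_n,x\rangle)_n$. A dual of $(v_n)_n$ is a frame or outer frame $(w_n)_n$ for $X$ such that $\sum_n w_n\langle v_n,x\rangle=x$ in norm for all $x\in X$; the operator $U^*U$ is invertible in $\mathbb B(X)$, and the sequence $((U^*U)^{-1}v_n)_n$ (for $v_n\in M(X)$, this is the composition of $v_n$ with $(U^*U)^{-1}$) is a dual of $(v_n)_n$, called the canonical dual. $X$ is full if the closed linear span of $\{\langle x,y\rangle:x,y\in X\}$ is $\mathsf A$. **Theorem.** Let $(v_n)_{n\in\mathbb N}$ be a frame or an outer frame for $X$ with analysis operator $U$. Consider the conditions: (a) $\mathrm N(U^*)=\{0\}$; (b) $\mathrm R(U)=\ell^2(\mathsf A)$; (c) the canonical dual is the only dual of $(v_n)_n$ (among all frames and outer frames). Then (a) and (b) are equivalent, and they imply (c). If $X$ is full, then (a), (b) and (c) are all equivalent. **Consequences.** (1) If $X$ is full and possesses a frame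 or an outer frame with a unique dual, then $X$ is unitarily equivalent to $\ell^2(\mathsf A)$, i.e. there is $W\in\mathbb B(X,\ell^2(\mathsf A))$ with $W^*W=I$ and $WW^*=I$. (2) If $\mathsf A$ has no unit element and $X$ is full, then every frame for $X$ has at least two duals (frames or outer frames). -/

import Mathlib

open Filter Topology
open scoped RightActions

namespace HilbertFrame

section InnerProduct

variable (A : Type*) [NonUnitalCStarAlgebra A] [PartialOrder A]
variable {X : Type*} [AddCommGroup X] [Module ℂ X] [Norm X] [SMul Aᵐᵒᵖ X] [CStarModule Aᵐᵒᵖ X]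

/-- The `A`-valued inner product `⟨x, y⟩` of a right (pre-)Hilbert `A`-module `X`.

Mathlib's `CStarModule B X` is written with an action of `B` that satisfies
`⟨x, b • y⟩ = b * ⟨x, y⟩`. For `B = Aᵐᵒᵖ` this is a right action of `A`, written `y <• a`, and
reading the inner product in `A` gives `⟨x, y <• a⟩ = ⟨x, y⟩ * a`, see `ip_rsmul_right`: so
`CStarModule Aᵐᵒᵖ X` says that `X` is a right Hilbert `A`-module (a Hilbert `A`-module once `X` is
complete). -/
def ip (x y : X) : A := MulOpposite.unop (inner Aᵐᵒᵖ x y)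

variable {A}

theorem ip_rsmul_right (x y : X) (a : A) : ip A x (y <• a) = ip A x y * a := by
  simp [ip]

theorem star_ip (x y : X) : star (ip A x y) = ip A y x := by
  rw [ip, ← MulOpposite.unop_star, CStarModule.star_inner, ip]

theorem ip_rsmul_left (x y : X) (a : A) : ip A (x <• a) y = star a * ip A x y := by
  rw [← star_ip, ip_rsmul_right, star_mul, star_ip]

theorem ip_eq_of_forall {y z : X} (h : ∀ x : X, ip A x y = ip A x z) : y = z := by
  have h0 : ip A (y - z) (y - z) = 0 := by
    have h1 : ip A (y - z) (y - z) = ip A (y - z) y - ip A (y - z) z := by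
      simp [ip, CStarModule.inner_sub_right (A := Aᵐᵒᵖ)]
    rw [h1, h, sub_self]
  have h2 : inner Aᵐᵒᵖ (y - z) (y - z) = 0 := MulOpposite.unop_injective h0
  exact sub_eq_zero.mp (CStarModule.inner_self.mp h2)

end InnerProduct

section Adjointable

variable (A : Type*) [NonUnitalCStarAlgebra A] [PartialOrder A]
variable (X : Type*) [AddCommGroup X] [Module ℂ X] [Norm X] [SMul Aᵐᵒᵖ X] [CStarModule Aᵐᵒᵖ X]
variable (Y : Type*) [AddCommGroup Y] [Module ℂ Y] [Norm Y] [SMul Aᵐᵒᵖ Y] [CStarModule Aᵐᵒᵖ Y]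
variable (Z : Type*) [AddCommGroup Z] [Module ℂ Z] [Norm Z] [SMul Aᵐᵒᵖ Z] [CStarModule Aᵐᵒᵖ Z]

/-- `𝔹(X, Y)`: the adjointable operators from `X` to `Y`, i.e. the maps `T : X → Y` for which there
is a map `T* : Y → X` with `⟨T x, y⟩ = ⟨x, T* y⟩`. The adjoint is determined by `T` (see
`Adjointable.ext_of_toFun`), and both are automatically `A`-linear, and bounded when `X` and `Y`
are complete. -/
structure Adjointable where
  /-- the operator `T` -/
  toFun : X → Y
  /-- its adjoint `T*` -/
  adj : Y → X
  ip_adj : ∀ x y, ip A (toFun x) y = ip A x (adj y)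

variable {A X Y Z}

namespace Adjointable

instance : CoeFun (Adjointable A X Y) (fun _ => X → Y) := ⟨Adjointable.toFun⟩

theorem ext_of_toFun {S T : Adjointable A X Y} (h : ∀ x, S x = T x) : S = T := by
  have h1 : S.toFun = T.toFun := funext h
  have h2 : S.adj = T.adj := by
    funext y
    refine ip_eq_of_forall (A := A) fun x => ?_
    rw [← S.ip_adj, ← T.ip_adj, h1]
  cases S; cases T; congr

/-- The adjoint operator `T* ∈ 𝔹(Y, X)`. -/
def adjoint (T : Adjointable A X Y) : Adjointable A Y X where
  toFun := T.adj
  adj := T.toFun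
  ip_adj y x := by rw [← star_ip, ← T.ip_adj, star_ip]

/-- The composition `S T ∈ 𝔹(X, Z)` of `T ∈ 𝔹(X, Y)` and `S ∈ 𝔹(Y, Z)`. -/
def comp (S : Adjointable A Y Z) (T : Adjointable A X Y) : Adjointable A X Z where
  toFun x := S (T x)
  adj z := T.adj (S.adj z)
  ip_adj x z := by rw [S.ip_adj, T.ip_adj]

variable (A X) in
/-- The identity operator `I ∈ 𝔹(X)`. -/
def id : Adjointable A X X where
  toFun x := x
  adj x := x
  ip_adj _ _ := rfl

end Adjointable

variable (A X Y) in
/-- Unitary equivalence of Hilbert `A`-modules: there is `W ∈ 𝔹(X, Y)` with `W* W = I` and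
`W W* = I`. -/
def UnitarilyEquivalent : Prop :=
  ∃ W : Adjointable A X Y,
    W.adjoint.comp W = Adjointable.id A X ∧ W.comp W.adjoint = Adjointable.id A Y

end Adjointable

/-- The series `∑ f n` converges to `s`: its partial sums tend to `s`. -/
def SeriesHasSum {M : Type*} [AddCommMonoid M] [TopologicalSpace M] (f : ℕ → M) (s : M) : Prop :=
  Tendsto (fun N => ∑ n ∈ Finset.range N, f n) atTop (𝓝 s)

section EllTwo

variable {A : Type*} [NonUnitalCStarAlgebra A]

theorem SeriesHasSum.add {f g : ℕ → A} {s t : A} (hf : SeriesHasSum f s)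
    (hg : SeriesHasSum g t) : SeriesHasSum (fun n => f n + g n) (s + t) := by
  simpa [SeriesHasSum, Finset.sum_add_distrib] using Tendsto.add hf hg

theorem SeriesHasSum.sub {f g : ℕ → A} {s t : A} (hf : SeriesHasSum f s)
    (hg : SeriesHasSum g t) : SeriesHasSum (fun n => f n - g n) (s - t) := by
  simpa [SeriesHasSum, Finset.sum_sub_distrib] using Tendsto.sub hf hg

theorem SeriesHasSum.smul {f : ℕ → A} {s : A} (hf : SeriesHasSum f s) (c : ℂ) :
    SeriesHasSum (fun n => c • f n) (c • s) := by
  simpa [SeriesHasSum, Finset.smul_sum] using Tendsto.const_smul hf c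

theorem SeriesHasSum.mul_left {f : ℕ → A} {s : A} (hf : SeriesHasSum f s) (c : A) :
    SeriesHasSum (fun n => c * f n) (c * s) := by
  simpa [SeriesHasSum, Finset.mul_sum] using Tendsto.const_mul c hf

theorem SeriesHasSum.mul_right {f : ℕ → A} {s : A} (hf : SeriesHasSum f s) (c : A) :
    SeriesHasSum (fun n => f n * c) (s * c) := by
  simpa [SeriesHasSum, Finset.sum_mul] using Tendsto.mul_const c hf

theorem SeriesHasSum.star {f : ℕ → A} {s : A} (hf : SeriesHasSum f s) :
    SeriesHasSum (fun n => star (f n)) (star s) := by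
  simpa [SeriesHasSum] using Tendsto.star hf

theorem SeriesHasSum.unique {f : ℕ → A} {s t : A} (hs : SeriesHasSum f s)
    (ht : SeriesHasSum f t) : s = t := tendsto_nhds_unique hs ht

variable [PartialOrder A] [StarOrderedRing A]

theorem exists_sum_of_le {f g : ℕ → A} (h0 : ∀ n, 0 ≤ f n) (hfg : ∀ n, f n ≤ g n)
    (hg : ∃ t, SeriesHasSum g t) : ∃ s, SeriesHasSum f s := by
  obtain ⟨t, ht⟩ := hg
  refine cauchySeq_tendsto_of_complete ?_
  have hc := ht.cauchySeq
  rw [Metric.cauchySeq_iff'] at hc ⊢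
  intro ε hε
  obtain ⟨N, hN⟩ := hc ε hε
  refine ⟨N, fun n hn => lt_of_le_of_lt ?_ (hN n hn)⟩
  rw [dist_eq_norm, dist_eq_norm, ← Finset.sum_Ico_eq_sub _ hn, ← Finset.sum_Ico_eq_sub _ hn]
  exact CStarAlgebra.norm_le_norm_of_nonneg_of_le (Finset.sum_nonneg fun i _ => h0 i)
    (Finset.sum_le_sum fun i _ => hfg i)

variable (A) in
/-- The sequences `(a n)` in `A` for which `∑ (a n)* (a n)` converges in norm. -/
def ellTwoSubmodule : Submodule ℂ (ℕ → A) where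
  carrier := {a | ∃ s, SeriesHasSum (fun n => star (a n) * a n) s}
  add_mem' := by
    rintro a b ⟨s, hs⟩ ⟨t, ht⟩
    refine exists_sum_of_le (fun n => star_mul_self_nonneg _) (fun n => ?_)
      ⟨_, (hs.add hs).add (ht.add ht)⟩
    have h : star (a n) * a n + star (a n) * a n + (star (b n) * b n + star (b n) * b n)
        = star ((a + b) n) * (a + b) n + star (a n - b n) * (a n - b n) := by
      simp only [Pi.add_apply, star_add, star_sub]
      noncomm_ring
    rw [h]
    exact le_add_of_nonneg_right (star_mul_self_nonneg _)
  zero_mem' := ⟨0, by simp [SeriesHasSum]⟩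
  smul_mem' := by
    rintro c a ⟨s, hs⟩
    refine ⟨(star c * c) • s, ?_⟩
    have h := hs.smul (star c * c)
    simpa [SeriesHasSum, smul_mul_smul_comm, star_smul] using h

variable (A) in
/-- The generalized Hilbert space `ℓ²(A)`: the sequences `(a n)` in `A` for which
`∑ (a n)* (a n)` converges in norm. -/
def EllTwo : Type _ := ellTwoSubmodule A

namespace EllTwo

instance : CoeFun (EllTwo A) (fun _ => ℕ → A) := ⟨fun a => a.1⟩

instance : AddCommGroup (EllTwo A) := inferInstanceAs (AddCommGroup (ellTwoSubmodule A))

instance : Module ℂ (EllTwo A) := inferInstanceAs (Module ℂ (ellTwoSubmodule A))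

/-- The right action of `A` on `ℓ²(A)`: `(a n) <• c = (a n * c)`. -/
instance : SMul Aᵐᵒᵖ (EllTwo A) where
  smul c a := ⟨fun n => a n * c.unop, by
    obtain ⟨s, hs⟩ := a.2
    refine ⟨star c.unop * s * c.unop, ?_⟩
    have h := (hs.mul_left (star c.unop)).mul_right c.unop
    simpa [mul_assoc] using h⟩

theorem ext {a b : EllTwo A} (h : ∀ n, a n = b n) : a = b := Subtype.ext (funext h)

@[simp] theorem add_apply (a b : EllTwo A) (n : ℕ) : (a + b) n = a n + b n := rfl

@[simp] theorem smul_apply (c : ℂ) (a : EllTwo A) (n : ℕ) : (c • a) n = c • a n := rfl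

@[simp] theorem rsmul_apply (a : EllTwo A) (c : A) (n : ℕ) : (a <• c) n = a n * c := rfl

@[simp] theorem zero_apply (n : ℕ) : (0 : EllTwo A) n = 0 := rfl

/-- The inner product `⟨(a n), (b n)⟩ = ∑ (a n)* (b n)` on `ℓ²(A)`, the limit of the partial sums;
they do converge, see `EllTwo.seriesHasSum`. -/
noncomputable def innerSum (a b : EllTwo A) : A :=
  limUnder atTop (fun N => ∑ n ∈ Finset.range N, star (a n) * b n)

theorem seriesHasSum (a b : EllTwo A) :
    SeriesHasSum (fun n => star (a n) * b n) (innerSum a b) := by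
  have key : ∃ s, SeriesHasSum (fun n => star (a n) * b n) s := by
    obtain ⟨s1, h1⟩ := (a + b).2
    obtain ⟨s2, h2⟩ := (a + (-1 : ℂ) • b).2
    obtain ⟨s3, h3⟩ := (a + Complex.I • b).2
    obtain ⟨s4, h4⟩ := (a + (-Complex.I) • b).2
    refine ⟨_, (((h1.sub h2).sub ((h3.sub h4).smul Complex.I)).smul (1 / 4)).congr fun N => ?_⟩
    refine Finset.sum_congr rfl fun n _ => ?_
    change (1 / 4 : ℂ) • (star (a n + b n) * (a n + b n)
        - star (a n + (-1 : ℂ) • b n) * (a n + (-1 : ℂ) • b n)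
        - Complex.I • (star (a n + Complex.I • b n) * (a n + Complex.I • b n)
          - star (a n + (-Complex.I) • b n) * (a n + (-Complex.I) • b n))) = star (a n) * b n
    simp only [star_add, star_smul, add_mul, mul_add, smul_mul_assoc, mul_smul_comm, smul_add,
      smul_sub, smul_smul, Complex.star_def, map_neg, Complex.conj_I, map_one]
    match_scalars <;>
      first | ring1 | linear_combination (-1 / 2 : ℂ) * Complex.I_sq |
        linear_combination (1 / 2 : ℂ) * Complex.I_sq
  obtain ⟨s, hs⟩ := key
  have h : innerSum a b = s := hs.limUnder_eq
  rw [h]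
  exact hs

noncomputable instance : Norm (EllTwo A) where
  norm a := √‖innerSum a a‖

/-- `ℓ²(A)` as a right `A`-module with its `A`-valued inner product. -/
noncomputable instance : CStarModule Aᵐᵒᵖ (EllTwo A) where
  inner a b := MulOpposite.op (innerSum a b)
  inner_add_right {a b c} := by
    refine MulOpposite.unop_injective ((seriesHasSum a (b + c)).unique ?_)
    simpa [mul_add] using (seriesHasSum a b).add (seriesHasSum a c)
  inner_self_nonneg {a} := by
    change 0 ≤ innerSum a a
    exact ge_of_tendsto' (seriesHasSum a a)
      fun N => Finset.sum_nonneg fun n _ => star_mul_self_nonneg _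
  inner_self {a} := by
    constructor
    · intro h
      have h0 : innerSum a a = 0 := MulOpposite.op_injective h
      refine EllTwo.ext fun n => ?_
      have hle : star (a n) * a n ≤ innerSum a a := by
        refine ge_of_tendsto (seriesHasSum a a) ?_
        filter_upwards [eventually_gt_atTop n] with N hN
        exact Finset.single_le_sum (f := fun n => star (a n) * a n)
          (fun i _ => star_mul_self_nonneg _) (Finset.mem_range.mpr hN)
      rw [h0] at hle
      exact CStarRing.star_mul_self_eq_zero_iff (a n) |>.mp
        (le_antisymm hle (star_mul_self_nonneg _))
    · rintro rfl
      refine MulOpposite.unop_injective ((seriesHasSum (0 : EllTwo A) 0).unique ?_)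
      simp [SeriesHasSum]
  inner_op_smul_right {c a b} := by
    refine MulOpposite.unop_injective ((seriesHasSum a (c • b)).unique ?_)
    have h := (seriesHasSum a b).mul_right c.unop
    simp only [mul_assoc] at h
    exact h
  inner_smul_right_complex {z a b} := by
    refine MulOpposite.unop_injective ((seriesHasSum a (z • b)).unique ?_)
    simpa [mul_smul_comm] using (seriesHasSum a b).smul z
  star_inner a b := by
    refine MulOpposite.unop_injective (SeriesHasSum.unique ?_ (seriesHasSum b a))
    simpa using (seriesHasSum a b).star
  norm_eq_sqrt_norm_inner_self a := rfl

end EllTwo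

end EllTwo

section Multiplier

variable {A : Type*} [NonUnitalCStarAlgebra A] [PartialOrder A] [StarOrderedRing A]

/-- `A` as a right Hilbert module over itself: `⟨a, b⟩ = a* b`. -/
noncomputable instance : CStarModule Aᵐᵒᵖ A where
  inner a b := MulOpposite.op (star a * b)
  inner_add_right := by simp [mul_add]
  inner_self_nonneg {a} := by
    change 0 ≤ star a * a
    exact star_mul_self_nonneg a
  inner_self := by simp
  inner_op_smul_right {c a b} := by
    apply MulOpposite.unop_injective
    simp [mul_assoc]
  inner_smul_right_complex := by simp [mul_smul_comm]
  star_inner a b := by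
    apply MulOpposite.unop_injective
    simp
  norm_eq_sqrt_norm_inner_self a := by
    rw [MulOpposite.norm_op, CStarRing.norm_star_mul_self, Real.sqrt_mul_self (norm_nonneg a)]

variable (A)
variable (X : Type*) [AddCommGroup X] [Module ℂ X] [Norm X] [SMul Aᵐᵒᵖ X] [CStarModule Aᵐᵒᵖ X]

/-- The multiplier module `M(X) = 𝔹(A, X)`. The module action of `a : A` on `v : M(X)` is
`v a = v(a) ∈ X`, and an operator `T ∈ 𝔹(X, Y)` extends to `M(X) → M(Y)` by `v ↦ T.comp v`. -/
abbrev MultiplierModule := Adjointable A A X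

variable {A X}

/-- The inner product `⟨v, x⟩ ∈ A` of `v ∈ M(X)` and `x ∈ X`, i.e. `v*(x)`. It is characterized by
`a* ⟨v, x⟩ = ⟨v a, x⟩` for `a : A`. -/
def MultiplierModule.pairing (v : MultiplierModule A X) (x : X) : A := v.adj x

variable (A) in
/-- The inclusion `X ⊆ M(X)`: the vector `x` acts as `a ↦ x a`, and `⟨x, y⟩` is as in `X`. -/
def MultiplierModule.ofVec (x : X) : MultiplierModule A X where
  toFun a := x <• a
  adj y := ip A x y
  ip_adj a y := by
    rw [ip_rsmul_left]
    rfl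

end Multiplier

section Frames

variable (A : Type*) [NonUnitalCStarAlgebra A] [PartialOrder A] [StarOrderedRing A]

/-- `A` has no unit element. -/
def IsNonUnital : Prop := ¬ ∃ e : A, ∀ a : A, e * a = a ∧ a * e = a

variable (X : Type*) [NormedAddCommGroup X] [NormedSpace ℂ X] [SMul Aᵐᵒᵖ X] [CStarModule Aᵐᵒᵖ X]

/-- `X` is full: the closed linear span of the inner products `⟨x, y⟩` is all of `A`. -/
def IsFull : Prop :=
  (Submodule.span ℂ {a : A | ∃ x y : X, a = ip A x y}).topologicalClosure = ⊤

variable {X}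

/-- `(x n)` is a frame for `X`: a sequence in `X` with
`C ⟨x, x⟩ ≤ ∑ ⟨x, x n⟩ ⟨x n, x⟩ ≤ D ⟨x, x⟩`, where the series converges in norm. -/
def IsFrame (u : ℕ → X) : Prop :=
  ∃ C D : ℝ, 0 < C ∧ 0 < D ∧ ∀ x : X, ∃ s : A,
    SeriesHasSum (fun n => ip A x (u n) * ip A (u n) x) s ∧
      C • ip A x x ≤ s ∧ s ≤ D • ip A x x

variable {A}

/-- `(v n)` is an outer frame for `X`: a sequence in `M(X)`, not all of whose members are in `X`,
with `C ⟨x, x⟩ ≤ ∑ ⟨x, v n⟩ ⟨v n, x⟩ ≤ D ⟨x, x⟩` for `x ∈ X`, where the series converges in norm;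
here `⟨x, v n⟩ = ⟨v n, x⟩*`. -/
def IsOuterFrame (v : ℕ → MultiplierModule A X) : Prop :=
  (∃ n, v n ∉ Set.range (MultiplierModule.ofVec A : X → MultiplierModule A X)) ∧
  ∃ C D : ℝ, 0 < C ∧ 0 < D ∧ ∀ x : X, ∃ s : A,
    SeriesHasSum (fun n => star ((v n).pairing x) * (v n).pairing x) s ∧
      C • ip A x x ≤ s ∧ s ≤ D • ip A x x

/-- A sequence in `M(X)` that is a frame (all its members are in `X`) or an outer frame. -/
def IsFrameOrOuterFrame (v : ℕ → MultiplierModule A X) : Prop :=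
  (∃ u : ℕ → X, IsFrame A u ∧ ∀ n, v n = MultiplierModule.ofVec A (u n)) ∨ IsOuterFrame v

/-- `U` is the analysis operator of `(v n)`: `U x = (⟨v n, x⟩)`. -/
def IsAnalysisOperator (v : ℕ → MultiplierModule A X) (U : Adjointable A X (EllTwo A)) : Prop :=
  ∀ (x : X) (n : ℕ), U x n = (v n).pairing x

/-- The frame or outer frame `(w n)` is a dual of `(v n)`: `∑ (w n) ⟨v n, x⟩ = x` for `x ∈ X`. -/
def IsDual (v w : ℕ → MultiplierModule A X) : Prop :=
  IsFrameOrOuterFrame w ∧ ∀ x : X, SeriesHasSum (fun n => w n ((v n).pairing x)) x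

/-- `(w n)` is the canonical dual of the sequence `(v n)` with analysis operator `U`: the operator
`U* U` is invertible in `𝔹(X)` and `w n = (U* U)⁻¹ (v n)` (in `M(X)` if `v n ∉ X`). -/
def IsCanonicalDual (U : Adjointable A X (EllTwo A)) (v w : ℕ → MultiplierModule A X) : Prop :=
  ∃ S : Adjointable A X X,
    S.comp (U.adjoint.comp U) = Adjointable.id A X ∧
    (U.adjoint.comp U).comp S = Adjointable.id A X ∧
    ∀ n, w n = S.comp (v n)

/-- The canonical dual of `(v n)` is a dual of `(v n)`, and its only one among all frames and outer
frames. -/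
def CanonicalDualIsOnlyDual (U : Adjointable A X (EllTwo A)) (v : ℕ → MultiplierModule A X) :
    Prop :=
  ∃ w, IsCanonicalDual U v w ∧ IsDual v w ∧ ∀ y, IsDual v y → y = w

end Frames

end HilbertFrame

/-! The proof turns duals into left inverses. The adjoint of an analysis operator is the synthesis
map `a ↦ ∑ v n (a n)`, and every adjointable `W : X → ℓ²(A)` is the analysis operator of exactly one
sequence in `M(X)`, namely `multipliersOf W`. So a sequence with frame bounds and analysis operator
`W` is a dual of `v` exactly when `W* U = I` (`isDual_multipliersOf`, `IsDual.exists_left_inverse`).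
Outer frames are what makes this correspondence complete. With `R = (U* U)⁻¹` the canonical dual
belongs to `W = U R`.

The operator `U R U*` is the projection onto the range of `U` with kernel `N(U*)`, so (a) and (b)
agree. If `U` is onto, `W* U = I` determines `W*`, hence the dual. Conversely, for `b ∈ N(U*)` and
`z ∈ X` the perturbation `U R + b⟨z, ·⟩` also gives a dual; uniqueness forces `b n * ⟨z, x⟩ = 0` for
all `z`, `x`, and fullness then gives `b = 0` (`IsGramInverse.adj_eq_zero_of_unique`).

For the consequences `U` is thus bijective. Its polar decomposition gives a unitary onto `ℓ²(A)`;
the square root of `U* U` comes from a fixed point argument (`exists_sqrt_one_sub`). If the `v n`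
lie in `X`, then `U R U* = I`, read in one coordinate, shows that `⟨u 0, R (u 0)⟩` is a unit of `A`
(`IsGramInverse.exists_unit`). -/

namespace HilbertFrame

/-! ### Inequalities for the `A`-valued inner product -/

section InnerProduct

variable {A : Type*} [NonUnitalCStarAlgebra A] [PartialOrder A]
variable {X : Type*} [AddCommGroup X] [Module ℂ X] [Norm X] [SMul Aᵐᵒᵖ X] [CStarModule Aᵐᵒᵖ X]

theorem ip_add_right (x y z : X) : ip A x (y + z) = ip A x y + ip A x z := by simp [ip]

theorem ip_add_left (x y z : X) : ip A (x + y) z = ip A x z + ip A y z := by simp [ip]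

theorem ip_sub_right (x y z : X) : ip A x (y - z) = ip A x y - ip A x z := by
  simp [ip, CStarModule.inner_sub_right (A := Aᵐᵒᵖ)]

theorem ip_sub_left (x y z : X) : ip A (x - y) z = ip A x z - ip A y z := by
  simp [ip, CStarModule.inner_sub_left (A := Aᵐᵒᵖ)]

theorem ip_smul_right (c : ℂ) (x y : X) : ip A x (c • y) = c • ip A x y := by simp [ip]

theorem ip_smul_left (c : ℂ) (x y : X) : ip A (c • x) y = star c • ip A x y := by
  simp [ip, CStarModule.inner_smul_left_complex (A := Aᵐᵒᵖ)]

theorem ip_zero_right (x : X) : ip A x 0 = 0 := by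
  simp [ip, CStarModule.inner_zero_right (A := Aᵐᵒᵖ)]

theorem ip_sum_right (s : Finset ℕ) (x : X) (f : ℕ → X) :
    ip A x (∑ n ∈ s, f n) = ∑ n ∈ s, ip A x (f n) := by
  simp [ip, CStarModule.inner_sum_right (A := Aᵐᵒᵖ)]

theorem ip_self_nonneg (x : X) : 0 ≤ ip A x x :=
  CStarModule.inner_self_nonneg (A := Aᵐᵒᵖ) (x := x)

theorem norm_ip_self (x : X) : ‖ip A x x‖ = ‖x‖ ^ 2 :=
  (CStarModule.norm_sq_eq Aᵐᵒᵖ (x := x)).symm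

/-- Positivity of `⟨x - t y, x - t y⟩`, expanded. -/
theorem smul_ip_add_ip_le [StarOrderedRing A] (t : ℝ) (x y : X) :
    t • (ip A x y + ip A y x) ≤ ip A x x + t ^ 2 • ip A y y := by
  have h := ip_self_nonneg (A := A) (x - (t : ℂ) • y)
  simp only [ip_sub_left, ip_sub_right, ip_smul_left, ip_smul_right, Complex.star_def,
    Complex.conj_ofReal] at h
  simp only [Complex.coe_smul] at h
  rw [← sub_nonneg]
  convert h using 1
  module

/-- The choice `t = 1/D` makes the last term at most `D⁻¹ • d`, which is absorbed on the left. This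
is the substitute for Cauchy–Schwarz that yields estimates in the order of `A` and not only in norm.
-/
theorem le_smul_of_forall_two_mul_smul_le [StarOrderedRing A] {d s e : A} {D : ℝ} (hD : 0 < D)
    (h : ∀ t : ℝ, (2 * t) • d ≤ s + t ^ 2 • e) (he : e ≤ D • d) : d ≤ D • s := by
  have h1 := (h D⁻¹).trans
    (add_le_add_right (smul_le_smul_of_nonneg_left he (by positivity : (0 : ℝ) ≤ D⁻¹ ^ 2)) s)
  have h2 : D⁻¹ ^ 2 • D • d = D⁻¹ • d := by
    rw [smul_smul]
    congr 1
    field_simp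
  rw [h2, mul_smul, two_smul, add_le_add_iff_right] at h1
  simpa [smul_smul, hD.ne'] using smul_le_smul_of_nonneg_left h1 hD.le

theorem ip_le_of_ip_eq [StarOrderedRing A] {x y : X} {d : A} {D : ℝ} (hD : 0 < D)
    (hxy : ip A x y = d) (hd : star d = d) (hy : ip A y y ≤ D • d) : d ≤ D • ip A x x := by
  refine le_smul_of_forall_two_mul_smul_le hD (fun t => ?_) hy
  have h := smul_ip_add_ip_le (A := A) t x y
  rw [← star_ip x y, hxy, hd] at h
  convert h using 1
  module

theorem norm_le_of_ip_le [StarOrderedRing A] {Y : Type*} [AddCommGroup Y] [Module ℂ Y] [Norm Y]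
    [SMul Aᵐᵒᵖ Y] [CStarModule Aᵐᵒᵖ Y] {x : X} {y : Y} {c : ℝ} (hc : 0 ≤ c)
    (h : ip A y y ≤ c • ip A x x) : ‖y‖ ≤ √c * ‖x‖ := by
  have h1 := CStarAlgebra.norm_le_norm_of_nonneg_of_le (ip_self_nonneg y) h
  rw [norm_smul, norm_ip_self, norm_ip_self, Real.norm_of_nonneg hc] at h1
  refine (sq_le_sq₀ (CStarModule.norm_nonneg Aᵐᵒᵖ) (mul_nonneg (Real.sqrt_nonneg _)
    (CStarModule.norm_nonneg Aᵐᵒᵖ))).mp ?_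
  rwa [mul_pow, Real.sq_sqrt hc]

theorem continuous_ip [StarOrderedRing A] {X : Type*} [NormedAddCommGroup X] [NormedSpace ℂ X]
    [SMul Aᵐᵒᵖ X] [CStarModule Aᵐᵒᵖ X] : Continuous fun p : X × X => ip A p.1 p.2 :=
  MulOpposite.continuous_unop.comp (CStarModule.continuous_inner (A := Aᵐᵒᵖ))

end InnerProduct

/-! ### Adjointable operators: linearity, inverse and square root of `U* U` -/

namespace Adjointable

section Algebraic

variable {A : Type*} [NonUnitalCStarAlgebra A] [PartialOrder A]
variable {X : Type*} [AddCommGroup X] [Module ℂ X] [Norm X] [SMul Aᵐᵒᵖ X] [CStarModule Aᵐᵒᵖ X]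
variable {Y : Type*} [AddCommGroup Y] [Module ℂ Y] [Norm Y] [SMul Aᵐᵒᵖ Y] [CStarModule Aᵐᵒᵖ Y]

theorem ip_apply_right (T : Adjointable A X Y) (y : Y) (x : X) :
    ip A y (T x) = ip A (T.adj y) x :=
  (T.adjoint.ip_adj y x).symm

theorem ext_of_adj {S T : Adjointable A X Y} (h : ∀ y, S.adj y = T.adj y) : S = T :=
  congrArg adjoint (ext_of_toFun (S := S.adjoint) (T := T.adjoint) h)

theorem map_add (T : Adjointable A X Y) (x y : X) : T (x + y) = T x + T y :=
  ip_eq_of_forall (A := A) fun z => by simp only [ip_apply_right, ip_add_right]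

theorem map_sub (T : Adjointable A X Y) (x y : X) : T (x - y) = T x - T y :=
  ip_eq_of_forall (A := A) fun z => by simp only [ip_apply_right, ip_sub_right]

theorem map_smul (T : Adjointable A X Y) (c : ℂ) (x : X) : T (c • x) = c • T x :=
  ip_eq_of_forall (A := A) fun z => by simp only [ip_apply_right, ip_smul_right]

theorem map_rsmul (T : Adjointable A X Y) (x : X) (a : A) : T (x <• a) = T x <• a :=
  ip_eq_of_forall (A := A) fun z => by simp only [ip_apply_right, ip_rsmul_right]

theorem map_zero (T : Adjointable A X Y) : T 0 = 0 :=
  ip_eq_of_forall (A := A) fun z => by simp only [ip_apply_right, ip_zero_right]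

/-- With `d = ⟨U* a, U* a⟩ = ⟨a, U U* a⟩`, the bound on `U` gives `⟨U U* a, U U* a⟩ ≤ D d`, so the
adjoint inherits the constant `D`. -/
theorem ip_adj_le [StarOrderedRing A] (U : Adjointable A X Y) {D : ℝ} (hD : 0 < D)
    (hU : ∀ x, ip A (U x) (U x) ≤ D • ip A x x) (a : Y) :
    ip A (U.adj a) (U.adj a) ≤ D • ip A a a :=
  ip_le_of_ip_eq hD (U.ip_apply_right a (U.adj a)) (star_ip _ _) (hU _)

/-- The operator `x ↦ x - t • U* U x`. -/
def oneSubSmul (U : Adjointable A X Y) (t : ℝ) : Adjointable A X X where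
  toFun x := x - (t : ℂ) • U.adj (U x)
  adj x := x - (t : ℂ) • U.adj (U x)
  ip_adj x y := by
    simp only [ip_sub_left, ip_sub_right, ip_smul_left, ip_smul_right, Complex.star_def,
      Complex.conj_ofReal]
    rw [← U.ip_apply_right, ← U.ip_adj]

/-- In the expanded square, the term `D⁻² ⟨U* U x, U* U x⟩` is at most `D⁻¹ ⟨U x, U x⟩` and cancels
half of the cross term; the lower bound on `U` controls the rest. -/
theorem ip_oneSubSmul_le [StarOrderedRing A] (U : Adjointable A X Y) {C D : ℝ} (hD : 0 < D)
    (hC : ∀ x, C • ip A x x ≤ ip A (U x) (U x))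
    (hU : ∀ x, ip A (U x) (U x) ≤ D • ip A x x) (x : X) :
    ip A (U.oneSubSmul D⁻¹ x) (U.oneSubSmul D⁻¹ x) ≤ (1 - D⁻¹ * C) • ip A x x := by
  have h1 : ip A (U.oneSubSmul D⁻¹ x) (U.oneSubSmul D⁻¹ x) = ip A x x
      - (2 * D⁻¹) • ip A (U x) (U x) + D⁻¹ ^ 2 • ip A (U.adj (U x)) (U.adj (U x)) := by
    simp only [oneSubSmul, ip_sub_left, ip_sub_right, ip_smul_left, ip_smul_right,
      Complex.star_def, Complex.conj_ofReal]
    rw [← U.ip_adj x (U x), ← U.ip_apply_right (U x) x]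
    simp only [Complex.coe_smul]
    module
  have h2 := smul_le_smul_of_nonneg_left (U.ip_adj_le hD hU (U x))
    (by positivity : (0 : ℝ) ≤ D⁻¹ ^ 2)
  have h3 : D⁻¹ ^ 2 • D • ip A (U x) (U x) = D⁻¹ • ip A (U x) (U x) := by
    rw [smul_smul]
    congr 1
    field_simp
  have h4 := smul_le_smul_of_nonneg_left (hC x) (by positivity : (0 : ℝ) ≤ D⁻¹)
  rw [h3] at h2
  rw [h1]
  calc _ ≤ ip A x x - (2 * D⁻¹) • ip A (U x) (U x) + D⁻¹ • ip A (U x) (U x) := by gcongr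
    _ = ip A x x - D⁻¹ • ip A (U x) (U x) := by module
    _ ≤ ip A x x - D⁻¹ • C • ip A x x := by gcongr
    _ = _ := by module

end Algebraic

section Bounded

variable {A : Type*} [NonUnitalCStarAlgebra A] [PartialOrder A] [StarOrderedRing A]
variable {X : Type*} [NormedAddCommGroup X] [NormedSpace ℂ X] [SMul Aᵐᵒᵖ X] [CStarModule Aᵐᵒᵖ X]
variable {Y : Type*} [AddCommGroup Y] [Module ℂ Y] [Norm Y] [SMul Aᵐᵒᵖ Y] [CStarModule Aᵐᵒᵖ Y]

variable (A) in
/-- `T` is self-adjoint for the `A`-valued inner product. -/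
def IsSymm (T : X →L[ℂ] X) : Prop := ∀ x y, ip A (T x) y = ip A x (T y)

/-- A symmetric bounded operator as an adjointable operator. -/
def ofIsSymm {T : X →L[ℂ] X} (hT : IsSymm A T) : Adjointable A X X := ⟨T, T, hT⟩

/-- `T = I - c⁻¹ U* U` with `c` an upper bound of `U`; this reduces inverse and square root of `U*
U` to those of `I - T`. -/
theorem exists_contraction (U : Adjointable A X Y) {C D : ℝ} (hC0 : 0 < C) (hD0 : 0 < D)
    (hC : ∀ x, C • ip A x x ≤ ip A (U x) (U x))
    (hD : ∀ x, ip A (U x) (U x) ≤ D • ip A x x) :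
    ∃ T : X →L[ℂ] X, ‖T‖ < 1 ∧ IsSymm A T ∧
      ∃ c : ℝ, 0 < c ∧ ∀ x, U.adj (U x) = (c : ℂ) • (x - T x) := by
  -- `C ≤ D` can fail when `X = 0`; enlarging `D` keeps `1 - E⁻¹ * C` nonnegative.
  obtain ⟨E, hCE, hDE⟩ : ∃ E, C ≤ E ∧ D ≤ E := ⟨max C D, le_max_left _ _, le_max_right _ _⟩
  have hE0 : 0 < E := hD0.trans_le hDE
  have hE : ∀ x, ip A (U x) (U x) ≤ E • ip A x x := fun x =>
    (hD x).trans (smul_le_smul_of_nonneg_right hDE (ip_self_nonneg x))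
  have hr0 : 0 ≤ 1 - E⁻¹ * C := by
    rw [sub_nonneg, inv_mul_le_one₀ hE0]
    exact hCE
  have hr1 : 1 - E⁻¹ * C < 1 := by
    have : 0 < E⁻¹ * C := by positivity
    linarith
  let S := U.oneSubSmul E⁻¹
  refine ⟨LinearMap.mkContinuous
    { toFun := S, map_add' := S.map_add, map_smul' := S.map_smul } (√(1 - E⁻¹ * C))
    (fun x => norm_le_of_ip_le (A := A) hr0 (U.ip_oneSubSmul_le hE0 hC hE x)), ?_,
    fun x y => S.ip_adj x y, E, hE0, fun x => ?_⟩
  · refine (LinearMap.mkContinuous_norm_le _ (Real.sqrt_nonneg _) _).trans_lt ?_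
    rw [Real.sqrt_lt' one_pos]
    simpa using hr1
  · change _ = (E : ℂ) • (x - (x - ((E⁻¹ : ℝ) : ℂ) • U.adj (U x)))
    rw [sub_sub_cancel, smul_smul, ← Complex.ofReal_mul, mul_inv_cancel₀ hE0.ne']
    simp

variable [CompleteSpace X]

omit [StarOrderedRing A] in
theorem exists_inverse_one_sub {T : X →L[ℂ] X} (hT : ‖T‖ < 1) (hs : IsSymm A T) :
    ∃ R : X →L[ℂ] X, IsSymm A R ∧ (∀ x, R (x - T x) = x) ∧ ∀ x, R x - T (R x) = x := by
  have h1 : ∀ x, ((Units.oneSub T hT)⁻¹).1 (x - T x) = x := fun x =>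
    DFunLike.congr_fun (Units.oneSub T hT).inv_mul x
  have h2 : ∀ x, ((Units.oneSub T hT)⁻¹).1 x - T (((Units.oneSub T hT)⁻¹).1 x) = x := fun x =>
    DFunLike.congr_fun (Units.oneSub T hT).mul_inv x
  refine ⟨((Units.oneSub T hT)⁻¹).1, fun x y => ?_, h1, h2⟩
  conv_lhs => rw [← h2 y]
  conv_rhs => rw [← h2 x]
  rw [ip_sub_left, ip_sub_right, hs]

/-- The equation `(I - Q)² = I - T` says `Q = (T + Q²)/2`. The right-hand side contracts the closed
set of symmetric `Q` with `‖Q‖ ≤ ‖T‖`, so Banach's fixed point theorem applies. -/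
theorem exists_sqrt_one_sub {T : X →L[ℂ] X} (hT : ‖T‖ < 1) (hs : IsSymm A T) :
    ∃ Q : X →L[ℂ] X, ‖Q‖ < 1 ∧ IsSymm A Q ∧
      ∀ x, (x - Q x) - Q (x - Q x) = x - T x := by
  let f : (X →L[ℂ] X) → (X →L[ℂ] X) := fun Q => (1 / 2 : ℝ) • (T + Q * Q)
  let s : Set (X →L[ℂ] X) := Metric.closedBall 0 ‖T‖ ∩ {Q | IsSymm A Q}
  have hclosed : IsClosed s := by
    refine Metric.isClosed_closedBall.inter ?_
    simp only [IsSymm, Set.ofPred_forall]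
    refine isClosed_iInter fun x => isClosed_iInter fun y => isClosed_eq ?_ ?_
    · exact continuous_ip.comp
        ((ContinuousLinearMap.apply ℂ X x).continuous.prodMk continuous_const)
    · exact continuous_ip.comp
        (continuous_const.prodMk (ContinuousLinearMap.apply ℂ X y).continuous)
  have hmaps : Set.MapsTo f s s := by
    rintro Q ⟨hQ, hQs⟩
    rw [mem_closedBall_zero_iff] at hQ
    refine ⟨?_, fun x y => ?_⟩
    · rw [mem_closedBall_zero_iff]
      calc ‖f Q‖ ≤ 1 / 2 * ‖T + Q * Q‖ := by
            refine (norm_smul_le (1 / 2 : ℝ) (T + Q * Q)).trans_eq ?_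
            norm_num
        _ ≤ 1 / 2 * (‖T‖ + ‖Q‖ * ‖Q‖) := by
            gcongr
            exact (norm_add_le _ _).trans (by gcongr; exact norm_mul_le _ _)
        _ ≤ 1 / 2 * (‖T‖ + ‖T‖ * 1) := by
            gcongr
            exact hQ.trans hT.le
        _ = ‖T‖ := by ring
    · change ip A ((1 / 2 : ℝ) • (T x + Q (Q x))) y = ip A x ((1 / 2 : ℝ) • (T y + Q (Q y)))
      simp only [← Complex.coe_smul, ip_smul_left, ip_smul_right, ip_add_left, ip_add_right,
        hs x y, Complex.star_def, Complex.conj_ofReal]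
      rw [hQs, hQs]
  have hcontr : ContractingWith ⟨‖T‖, norm_nonneg T⟩ (hmaps.restrict f s s) := by
    refine ⟨by exact_mod_cast hT, LipschitzWith.of_dist_le_mul ?_⟩
    rintro ⟨P, hP, _⟩ ⟨Q, hQ, _⟩
    rw [mem_closedBall_zero_iff] at hP hQ
    change dist (f P) (f Q) ≤ ‖T‖ * dist P Q
    rw [dist_eq_norm, dist_eq_norm]
    -- Noncommutative difference of squares: the two terms and the factor `1/2` produce the
    -- Lipschitz constant `‖T‖`.
    have h1 : f P - f Q = (1 / 2 : ℝ) • (P * (P - Q) + (P - Q) * Q) := by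
      simp only [f, mul_sub, sub_mul]
      module
    rw [h1]
    calc _ ≤ 1 / 2 * ‖P * (P - Q) + (P - Q) * Q‖ := by
          refine (norm_smul_le (1 / 2 : ℝ) (P * (P - Q) + (P - Q) * Q)).trans_eq ?_
          norm_num
      _ ≤ 1 / 2 * (‖P‖ * ‖P - Q‖ + ‖P - Q‖ * ‖Q‖) := by
          gcongr
          exact (norm_add_le _ _).trans (by gcongr <;> exact norm_mul_le _ _)
      _ ≤ 1 / 2 * (‖T‖ * ‖P - Q‖ + ‖P - Q‖ * ‖T‖) := by gcongr
      _ = ‖T‖ * ‖P - Q‖ := by ring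
  have h0 : (0 : X →L[ℂ] X) ∈ s := by
    refine ⟨by simp, fun x y => ?_⟩
    have := ip_zero_right (A := A) y
    simp only [_root_.zero_apply, ip_zero_right]
    rw [← star_ip, this, star_zero]
  obtain ⟨Q, ⟨hQ, hQs⟩, hfix, -⟩ :=
    hcontr.exists_fixedPoint' hclosed.isComplete hmaps h0 (edist_ne_top _ _)
  rw [mem_closedBall_zero_iff] at hQ
  refine ⟨Q, hQ.trans_lt hT, hQs, fun x => ?_⟩
  have h1 : (1 / 2 : ℝ) • (T x + Q (Q x)) = Q x := DFunLike.congr_fun hfix x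
  have h2 : T x + Q (Q x) = (2 : ℝ) • Q x := by
    have h3 := congrArg (fun y => (2 : ℝ) • y) h1
    simpa only [smul_smul, mul_one_div_cancel (two_ne_zero' ℝ), one_smul] using h3
  rw [_root_.map_sub, eq_sub_of_add_eq h2]
  module

/-- If `U` is bounded and bounded below then `U* U` is invertible in `𝔹(X)`. -/
theorem exists_inverse (U : Adjointable A X Y) {C D : ℝ} (hC0 : 0 < C) (hD0 : 0 < D)
    (hC : ∀ x, C • ip A x x ≤ ip A (U x) (U x))
    (hD : ∀ x, ip A (U x) (U x) ≤ D • ip A x x) :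
    ∃ R : Adjointable A X X, (∀ x, R (U.adj (U x)) = x) ∧ (∀ x, U.adj (U (R x)) = x) ∧
      ∀ x, R.adj x = R x := by
  obtain ⟨T, hT, hTs, c, hc, h⟩ := U.exists_contraction hC0 hD0 hC hD
  obtain ⟨R, hRs, hR1, hR2⟩ := exists_inverse_one_sub hT hTs
  have hc' : (c : ℂ) ≠ 0 := by exact_mod_cast hc.ne'
  have hs : IsSymm A ((c : ℂ)⁻¹ • R) := fun x y => by
    change ip A ((c : ℂ)⁻¹ • R x) y = ip A x ((c : ℂ)⁻¹ • R y)
    rw [ip_smul_left, ip_smul_right, hRs x y, star_inv₀, Complex.star_def, Complex.conj_ofReal]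
  refine ⟨ofIsSymm hs, fun x => ?_, fun x => ?_, fun x => rfl⟩
  · change (c : ℂ)⁻¹ • R (U.adj (U x)) = x
    rw [h, _root_.map_smul, hR1, smul_smul, inv_mul_cancel₀ hc', one_smul]
  · change U.adj (U ((c : ℂ)⁻¹ • R x)) = x
    rw [h, _root_.map_smul, ← smul_sub, hR2, smul_smul, mul_inv_cancel₀ hc', one_smul]

/-- If `U` is surjective, bounded and bounded below, then the isometry in its polar decomposition
is unitary. -/
theorem unitarilyEquivalent_of_surjective (U : Adjointable A X Y) {C D : ℝ} (hC0 : 0 < C)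
    (hD0 : 0 < D) (hC : ∀ x, C • ip A x x ≤ ip A (U x) (U x))
    (hD : ∀ x, ip A (U x) (U x) ≤ D • ip A x x) (hU : Function.Surjective U.toFun) :
    UnitarilyEquivalent A X Y := by
  obtain ⟨T, hT, hTs, c, hc, h⟩ := U.exists_contraction hC0 hD0 hC hD
  obtain ⟨Q, hQ, hQs, hQT⟩ := exists_sqrt_one_sub hT hTs
  obtain ⟨R, hRs, hR1, hR2⟩ := exists_inverse_one_sub hQ hQs
  have hc' : ((√c : ℝ) : ℂ) ≠ 0 := by exact_mod_cast (Real.sqrt_pos.mpr hc).ne'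
  have hcc : (c : ℂ) = (√c : ℝ) * (√c : ℝ) := by exact_mod_cast (Real.mul_self_sqrt hc.le).symm
  have hs : IsSymm A (((√c : ℝ) : ℂ)⁻¹ • R) := fun x y => by
    change ip A (((√c : ℝ) : ℂ)⁻¹ • R x) y = ip A x (((√c : ℝ) : ℂ)⁻¹ • R y)
    rw [ip_smul_left, ip_smul_right, hRs x y, star_inv₀, Complex.star_def, Complex.conj_ofReal]
  -- `U* U = c (I - Q)²` and `R = (I - Q)⁻¹`, so `√c⁻¹ R` is the inverse of the positive square root
  -- and `W* W = I`.
  let W : Adjointable A X Y := U.comp (ofIsSymm hs)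
  have hW1 : ∀ x, W.adj (W x) = x := fun x => by
    change ((√c : ℝ) : ℂ)⁻¹ • R (U.adj (U (((√c : ℝ) : ℂ)⁻¹ • R x))) = x
    rw [h, ← hQT, _root_.map_smul Q, ← smul_sub, hR2, _root_.map_smul Q, ← smul_sub, smul_smul,
      hcc, mul_inv_cancel_right₀ hc', _root_.map_smul, hR1, smul_smul, inv_mul_cancel₀ hc',
      one_smul]
  have hW2 : Function.Surjective W.toFun := fun y => by
    obtain ⟨x, rfl⟩ := hU y
    refine ⟨((√c : ℝ) : ℂ) • (x - Q x), ?_⟩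
    change U (((√c : ℝ) : ℂ)⁻¹ • R (((√c : ℝ) : ℂ) • (x - Q x))) = U x
    rw [_root_.map_smul, smul_smul, inv_mul_cancel₀ hc', one_smul, hR1]
  -- A surjective `W` with `W* W = I` satisfies `W W* = I`: write `y = W x`.
  refine ⟨W, ext_of_toFun hW1, ext_of_toFun fun y => ?_⟩
  obtain ⟨x, rfl⟩ := hW2 y
  exact congrArg W.toFun (hW1 x)

end Bounded

end Adjointable

/-! ### Series and coordinates in `ℓ²(A)` -/

section Series

theorem SeriesHasSum.map {M N : Type*} [AddCommMonoid M] [TopologicalSpace M] [AddCommMonoid N]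
    [TopologicalSpace N] {f : ℕ → M} {s : M} (hf : SeriesHasSum f s) {g : M → N} (hg : Continuous g)
    (hsum : ∀ N, g (∑ n ∈ Finset.range N, f n) = ∑ n ∈ Finset.range N, g (f n)) :
    SeriesHasSum (fun n => g (f n)) (g s) :=
  ((hg.tendsto s).comp hf).congr hsum

variable {A : Type*} [NonUnitalCStarAlgebra A] [PartialOrder A] [StarOrderedRing A]

theorem SeriesHasSum.sum_le {f : ℕ → A} {s : A} (hf : SeriesHasSum f s) (h0 : ∀ n, 0 ≤ f n)
    (F : Finset ℕ) : ∑ n ∈ F, f n ≤ s := by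
  obtain ⟨N, hN⟩ := F.exists_nat_subset_range
  refine ge_of_tendsto hf ?_
  filter_upwards [eventually_ge_atTop N] with M hM
  exact Finset.sum_le_sum_of_subset_of_nonneg
    (hN.trans (Finset.range_subset_range.mpr hM)) fun i _ _ => h0 i

namespace EllTwo

theorem seriesHasSum_ip (a b : EllTwo A) : SeriesHasSum (fun n => star (a n) * b n) (ip A a b) :=
  seriesHasSum a b

/-- The sequence `(0, …, 0, a, 0, …)` with the entry `a` in position `k`. -/
noncomputable def single (k : ℕ) (a : A) : EllTwo A :=
  ⟨Pi.single k a, star a * a, by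
    refine tendsto_const_nhds.congr' ?_
    filter_upwards [eventually_gt_atTop k] with N hN
    rw [Finset.sum_eq_single_of_mem k (Finset.mem_range.mpr hN) fun n _ hn => by simp [hn]]
    simp⟩

theorem single_same (k : ℕ) (a : A) : single k a k = a := by
  change (Pi.single k a : ℕ → A) k = a
  simp

theorem single_of_ne {k n : ℕ} (h : n ≠ k) (a : A) : single k a n = 0 := by
  change (Pi.single k a : ℕ → A) n = 0
  simp [h]

theorem ip_single_left (k : ℕ) (a : A) (b : EllTwo A) : ip A (single k a) b = star a * b k := by
  refine (seriesHasSum_ip _ _).unique (tendsto_const_nhds.congr' ?_)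
  filter_upwards [eventually_gt_atTop k] with N hN
  rw [Finset.sum_eq_single_of_mem k (Finset.mem_range.mpr hN) fun n _ hn => by
    simp [single_of_ne hn], single_same]

end EllTwo

end Series

/-! ### Analysis operators and their correspondence with sequences in `M(X)` -/

section Analysis

variable {A : Type*} [NonUnitalCStarAlgebra A] [PartialOrder A] [StarOrderedRing A]
variable {X : Type*} [NormedAddCommGroup X] [NormedSpace ℂ X] [SMul Aᵐᵒᵖ X] [CStarModule Aᵐᵒᵖ X]

/-- The frame inequalities for a sequence in `M(X)` with constants `C` and `D`. -/
def HasFrameBounds (v : ℕ → MultiplierModule A X) (C D : ℝ) : Prop :=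
  0 < C ∧ 0 < D ∧ ∀ x : X, ∃ s : A,
    SeriesHasSum (fun n => star ((v n).pairing x) * (v n).pairing x) s ∧
      C • ip A x x ≤ s ∧ s ≤ D • ip A x x

/-- Frames and outer frames differ only in whether all members lie in `X`, so their union is
described by the inequalities alone. -/
theorem isFrameOrOuterFrame_iff (v : ℕ → MultiplierModule A X) :
    IsFrameOrOuterFrame v ↔ ∃ C D, HasFrameBounds v C D := by
  have key : ∀ u : ℕ → X, (∀ n, v n = MultiplierModule.ofVec A (u n)) → ∀ x n,
      star ((v n).pairing x) * (v n).pairing x = ip A x (u n) * ip A (u n) x := by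
    intro u hu x n
    rw [hu]
    change star (ip A (u n) x) * ip A (u n) x = _
    rw [star_ip]
  constructor
  · rintro (⟨u, ⟨C, D, hC, hD, h⟩, hu⟩ | ⟨-, h⟩)
    · refine ⟨C, D, hC, hD, fun x => ?_⟩
      simp only [key u hu]
      exact h x
    · exact h
  · rintro ⟨C, D, hC, hD, h⟩
    by_cases hv : ∀ n, v n ∈ Set.range (MultiplierModule.ofVec A : X → MultiplierModule A X)
    · choose u hu using hv
      refine Or.inl ⟨u, ⟨C, D, hC, hD, fun x => ?_⟩, fun n => (hu n).symm⟩
      simpa only [key u fun n => (hu n).symm] using h x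
    · push Not at hv
      exact Or.inr ⟨hv, C, D, hC, hD, h⟩

/-- Expanding `⟨y, y⟩` in one argument pairs `a n` with `⟨v n, y⟩`. The quadratic inequality in each
coordinate, together with the upper frame bound at `y` itself, allows the choice `t = 1/D`. This
bound makes the synthesis series Cauchy. -/
theorem ip_sum_le_of_hasFrameBounds {v : ℕ → MultiplierModule A X} {C D : ℝ}
    (hv : HasFrameBounds v C D) (a : ℕ → A) (F : Finset ℕ) :
    ip A (∑ n ∈ F, v n (a n)) (∑ n ∈ F, v n (a n)) ≤ D • ∑ n ∈ F, star (a n) * a n := by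
  set y := ∑ n ∈ F, v n (a n) with hy
  obtain ⟨-, hD, h⟩ := hv
  obtain ⟨s, hs, -, hsD⟩ := h y
  have h1 : ip A y y = ∑ n ∈ F, star ((v n).pairing y) * a n := by
    conv_lhs => rw [hy, ip_sum_right, ← hy]
    exact Finset.sum_congr rfl fun n _ => (v n).ip_apply_right y (a n)
  have h2 : ip A y y = ∑ n ∈ F, star (a n) * (v n).pairing y := by
    rw [← star_ip, h1, star_sum]
    simp
  refine le_smul_of_forall_two_mul_smul_le hD (fun t => ?_)
    ((hs.sum_le (fun n => star_mul_self_nonneg _) F).trans hsD)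
  have h3 : (2 * t) • ip A y y = ∑ n ∈ F,
      t • (ip A (a n) ((v n).pairing y) + ip A ((v n).pairing y) (a n)) := by
    rw [← Finset.smul_sum, Finset.sum_add_distrib, mul_comm, mul_smul, two_smul]
    congr 1
    exact congrArg₂ (· + ·) h2 h1
  rw [h3, Finset.smul_sum, ← Finset.sum_add_distrib]
  exact Finset.sum_le_sum fun n _ => smul_ip_add_ip_le t (a n) ((v n).pairing y)

theorem exists_seriesHasSum_synthesis [CompleteSpace X] {v : ℕ → MultiplierModule A X} {C D : ℝ}
    (hv : HasFrameBounds v C D) (a : EllTwo A) :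
    ∃ y : X, SeriesHasSum (fun n => v n (a n)) y := by
  refine cauchySeq_tendsto_of_complete ?_
  have hc := (EllTwo.seriesHasSum_ip a a).cauchySeq
  rw [Metric.cauchySeq_iff'] at hc ⊢
  have hD := hv.2.1
  intro ε hε
  -- The squared norm of a block of the synthesis series is at most `D` times the norm of the
  -- matching block of `∑ (a n)* (a n)`.
  obtain ⟨N, hN⟩ := hc (ε ^ 2 / D) (by positivity)
  refine ⟨N, fun n hn => lt_of_pow_lt_pow_left₀ 2 hε.le ?_⟩
  have h1 := hN n hn
  rw [dist_eq_norm, ← Finset.sum_Ico_eq_sub _ hn] at h1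
  rw [dist_eq_norm, ← Finset.sum_Ico_eq_sub _ hn, ← norm_ip_self (A := A)]
  refine (CStarAlgebra.norm_le_norm_of_nonneg_of_le (ip_self_nonneg _)
    (ip_sum_le_of_hasFrameBounds hv a _)).trans_lt ?_
  rw [norm_smul, Real.norm_of_nonneg hD.le, mul_comm]
  exact (lt_div_iff₀ hD).mp h1

theorem exists_isAnalysisOperator [CompleteSpace X] {v : ℕ → MultiplierModule A X} {C D : ℝ}
    (hv : HasFrameBounds v C D) :
    ∃ U : Adjointable A X (EllTwo A), IsAnalysisOperator v U := by
  choose s hs _ _ using hv.2.2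
  choose Z hZ using exists_seriesHasSum_synthesis hv
  refine ⟨⟨fun x => ⟨fun n => (v n).pairing x, s x, hs x⟩, Z, fun x a => ?_⟩, fun x n => rfl⟩
  refine (EllTwo.seriesHasSum_ip _ a).unique ?_
  have h1 := (hZ a).map (g := ip A x) (continuous_ip.comp (continuous_const.prodMk continuous_id))
    fun N => ip_sum_right _ _ _
  refine h1.congr fun N => Finset.sum_congr rfl fun n _ => (v n).ip_apply_right x (a n)

/-- The synthesis series already converges; pairing its sum with an arbitrary `x` identifies it as
`U* a`. -/
theorem IsAnalysisOperator.seriesHasSum_adj [CompleteSpace X] {v : ℕ → MultiplierModule A X}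
    {C D : ℝ} (hv : HasFrameBounds v C D) {U : Adjointable A X (EllTwo A)}
    (hU : IsAnalysisOperator v U) (a : EllTwo A) :
    SeriesHasSum (fun n => v n (a n)) (U.adj a) := by
  obtain ⟨y, hy⟩ := exists_seriesHasSum_synthesis hv a
  have h : U.adj a = y := ip_eq_of_forall (A := A) fun x => by
    have h1 := hy.map (g := ip A x) (continuous_ip.comp (continuous_const.prodMk continuous_id))
      fun N => ip_sum_right _ _ _
    rw [← U.ip_adj]
    refine (EllTwo.seriesHasSum_ip (U x) a).unique (h1.congr fun N => ?_)
    refine Finset.sum_congr rfl fun n _ => ?_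
    refine ((v n).ip_apply_right x (a n)).trans ?_
    exact congrArg (fun c => star c * a n) (hU x n).symm
  rwa [h]

theorem IsAnalysisOperator.ip_bounds {v : ℕ → MultiplierModule A X}
    {C D : ℝ} (hv : HasFrameBounds v C D) {U : Adjointable A X (EllTwo A)}
    (hU : IsAnalysisOperator v U) (x : X) :
    C • ip A x x ≤ ip A (U x) (U x) ∧ ip A (U x) (U x) ≤ D • ip A x x := by
  obtain ⟨s, hs, hC, hD⟩ := hv.2.2 x
  have h : s = ip A (U x) (U x) := by
    refine hs.unique ?_
    simpa only [hU x] using EllTwo.seriesHasSum_ip (U x) (U x)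
  rw [← h]
  exact ⟨hC, hD⟩

/-- The sequence in `M(X)` whose analysis operator is `W`. -/
noncomputable def multipliersOf (W : Adjointable A X (EllTwo A)) (n : ℕ) :
    MultiplierModule A X where
  toFun a := W.adj (EllTwo.single n a)
  adj x := W x n
  ip_adj a x := by
    rw [← star_ip, ← W.ip_adj, star_ip]
    exact EllTwo.ip_single_left n a (W x)

theorem isAnalysisOperator_multipliersOf (W : Adjointable A X (EllTwo A)) :
    IsAnalysisOperator (multipliersOf W) W := fun _ _ => rfl

theorem IsAnalysisOperator.eq_multipliersOf {v : ℕ → MultiplierModule A X}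
    {U : Adjointable A X (EllTwo A)} (hU : IsAnalysisOperator v U) : v = multipliersOf U :=
  funext fun n => Adjointable.ext_of_adj fun x => (hU x n).symm

/-- A bounded operator `W` with `W* U = I` is the analysis operator of a dual of `v`. -/
theorem isDual_multipliersOf [CompleteSpace X] {v : ℕ → MultiplierModule A X} {C D E : ℝ}
    (hv : HasFrameBounds v C D) {U : Adjointable A X (EllTwo A)} (hU : IsAnalysisOperator v U)
    {W : Adjointable A X (EllTwo A)} (hE : 0 < E) (hW : ∀ x, ip A (W x) (W x) ≤ E • ip A x x)
    (h : ∀ x, W.adj (U x) = x) : IsDual v (multipliersOf W) := by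
  have hD := hv.2.1
  have h' : ∀ x, U.adj (W x) = x := fun x => ip_eq_of_forall (A := A) fun y => by
    rw [← U.ip_adj, W.ip_apply_right, h]
  -- The lower bound comes from `x = U* W x` and the bound `D` for `U*`.
  have hb : HasFrameBounds (multipliersOf W) D⁻¹ E := by
    refine ⟨by positivity, hE, fun x => ⟨_, EllTwo.seriesHasSum_ip (W x) (W x), ?_, hW x⟩⟩
    have h1 := U.ip_adj_le hD (fun x => (hU.ip_bounds hv x).2) (W x)
    rw [h'] at h1
    simpa [smul_smul, hD.ne'] using
      smul_le_smul_of_nonneg_left h1 (by positivity : (0 : ℝ) ≤ D⁻¹)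
  refine ⟨(isFrameOrOuterFrame_iff _).mpr ⟨_, _, hb⟩, fun x => ?_⟩
  have h2 := (isAnalysisOperator_multipliersOf W).seriesHasSum_adj hb (U x)
  rw [h] at h2
  simpa only [hU x] using h2

theorem IsDual.exists_left_inverse [CompleteSpace X] {v w : ℕ → MultiplierModule A X}
    (hvw : IsDual v w) {U : Adjointable A X (EllTwo A)} (hU : IsAnalysisOperator v U) :
    ∃ W : Adjointable A X (EllTwo A), IsAnalysisOperator w W ∧ ∀ x, W.adj (U x) = x := by
  obtain ⟨C, D, hw⟩ := (isFrameOrOuterFrame_iff _).mp hvw.1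
  obtain ⟨W, hW⟩ := exists_isAnalysisOperator hw
  refine ⟨W, hW, fun x => ?_⟩
  have h1 := hW.seriesHasSum_adj hw (U x)
  simp only [hU x] at h1
  exact tendsto_nhds_unique h1 (hvw.2 x)

/-- The rank one operator `x ↦ b ⟨z, x⟩`. -/
noncomputable def rankOne (b : EllTwo A) (z : X) : Adjointable A X (EllTwo A) where
  toFun x := b <• ip A z x
  adj a := z <• ip A b a
  ip_adj x a := by rw [ip_rsmul_left, ip_rsmul_right, star_ip]

theorem exists_ip_rankOne_le (b : EllTwo A) (z : X) :
    ∃ E : ℝ, 0 < E ∧ ∀ x, ip A (rankOne b z x) (rankOne b z x) ≤ E • ip A x x := by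
  -- The summand `1` only keeps the constant positive when `b` or `z` vanishes.
  refine ⟨‖ip A b b‖ * ‖z‖ ^ 2 + 1, by positivity, fun x => ?_⟩
  have h1 : ip A (rankOne b z x) (rankOne b z x) = star (ip A z x) * ip A b b * ip A z x := by
    change ip A (b <• ip A z x) (b <• ip A z x) = _
    rw [ip_rsmul_left, ip_rsmul_right, mul_assoc]
  have h2 : star (ip A z x) * ip A z x ≤ ‖z‖ ^ 2 • ip A x x := by
    rw [star_ip]
    exact CStarModule.inner_mul_inner_swap_le (A := Aᵐᵒᵖ) (x := z) (y := x)
  rw [h1]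
  calc _ ≤ ‖ip A b b‖ • (star (ip A z x) * ip A z x) :=
        CStarAlgebra.star_left_conjugate_le_norm_smul (star_ip b b)
    _ ≤ ‖ip A b b‖ • ‖z‖ ^ 2 • ip A x x := smul_le_smul_of_nonneg_left h2 (norm_nonneg _)
    _ = (‖ip A b b‖ * ‖z‖ ^ 2) • ip A x x := smul_smul _ _ _
    _ ≤ _ := smul_le_smul_of_nonneg_right (by linarith) (ip_self_nonneg x)

theorem ip_add_self_le {Y : Type*} [AddCommGroup Y] [Module ℂ Y] [Norm Y] [SMul Aᵐᵒᵖ Y]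
    [CStarModule Aᵐᵒᵖ Y] (x y : Y) :
    ip A (x + y) (x + y) ≤ (2 : ℝ) • (ip A x x + ip A y y) := by
  have h := smul_ip_add_ip_le (A := A) 1 x y
  rw [one_smul, one_pow, one_smul] at h
  calc ip A (x + y) (x + y) = ip A x x + ip A y y + (ip A x y + ip A y x) := by
        simp only [ip_add_left, ip_add_right]
        abel
    _ ≤ ip A x x + ip A y y + (ip A x x + ip A y y) := by gcongr
    _ = _ := (two_smul ℝ _).symm

/-- The sum of two adjointable operators. -/
def Adjointable.add {Y : Type*} [AddCommGroup Y] [Module ℂ Y] [Norm Y] [SMul Aᵐᵒᵖ Y]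
    [CStarModule Aᵐᵒᵖ Y] (S T : Adjointable A X Y) : Adjointable A X Y where
  toFun x := S x + T x
  adj y := S.adj y + T.adj y
  ip_adj x y := by rw [ip_add_left, ip_add_right, S.ip_adj, T.ip_adj]

omit [StarOrderedRing A] in
-- The right annihilator of `c` is a closed subspace containing all inner products, hence is `A`; in
-- particular it contains `star c`.
theorem IsFull.eq_zero_of_mul_ip (hX : IsFull A X) {c : A}
    (hc : ∀ x y : X, c * ip A x y = 0) : c = 0 := by
  have h1 : (Submodule.span ℂ {a : A | ∃ x y : X, a = ip A x y}).topologicalClosure ≤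
      LinearMap.ker (ContinuousLinearMap.mul ℂ A c).toLinearMap := by
    refine Submodule.topologicalClosure_minimal _ (Submodule.span_le.mpr ?_)
      (ContinuousLinearMap.mul ℂ A c).isClosed_ker
    rintro _ ⟨x, y, rfl⟩
    exact hc x y
  have h2 : c * star c = 0 := h1 (hX.symm ▸ Submodule.mem_top : star c ∈ _)
  exact CStarRing.mul_star_self_eq_zero_iff c |>.mp h2

end Analysis

/-! ### Canonical dual, uniqueness of duals, and the unit -/

section Duals

variable {A : Type*} [NonUnitalCStarAlgebra A] [PartialOrder A] [StarOrderedRing A]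
variable {X : Type*} [NormedAddCommGroup X] [NormedSpace ℂ X] [CompleteSpace X]
variable [SMul Aᵐᵒᵖ X] [CStarModule Aᵐᵒᵖ X]

/-- `R` is the self-adjoint inverse of `U* U`. -/
structure IsGramInverse (U : Adjointable A X (EllTwo A)) (R : Adjointable A X X) : Prop where
  left_inv : ∀ x, R (U.adj (U x)) = x
  right_inv : ∀ x, U.adj (U (R x)) = x
  adj_eq : ∀ x, R.adj x = R x

variable {v : ℕ → MultiplierModule A X} {C D : ℝ} {U : Adjointable A X (EllTwo A)}
variable {R : Adjointable A X X}

theorem IsAnalysisOperator.exists_isGramInverse (hU : IsAnalysisOperator v U)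
    (hv : HasFrameBounds v C D) : ∃ R, IsGramInverse U R := by
  obtain ⟨R, h1, h2, h3⟩ := U.exists_inverse hv.1 hv.2.1 (fun x => (hU.ip_bounds hv x).1)
    (fun x => (hU.ip_bounds hv x).2)
  exact ⟨R, h1, h2, h3⟩

omit [CompleteSpace X] in
theorem IsGramInverse.isCanonicalDual (hR : IsGramInverse U R) (hU : IsAnalysisOperator v U) :
    IsCanonicalDual U v (multipliersOf (U.comp R)) := by
  refine ⟨R, Adjointable.ext_of_toFun hR.left_inv, Adjointable.ext_of_toFun hR.right_inv,
    fun n => Adjointable.ext_of_adj fun x => ?_⟩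
  change U (R x) n = (v n).adj (R.adj x)
  rw [hR.adj_eq]
  exact hU (R x) n

omit [CompleteSpace X] in
-- Here `⟨U R x, U R x⟩ = ⟨x, R x⟩`, and the lower frame bound at `R x` bounds `⟨R x, R x⟩` by `C⁻¹`
-- times it. This gives the upper frame bound of the canonical dual.
theorem IsGramInverse.ip_comp_le (hR : IsGramInverse U R) (hU : IsAnalysisOperator v U)
    (hv : HasFrameBounds v C D) (x : X) :
    ip A (U (R x)) (U (R x)) ≤ C⁻¹ • ip A x x := by
  have hC := hv.1
  have h1 : ip A (U (R x)) (U (R x)) = ip A x (R x) := by rw [U.ip_apply_right, hR.right_inv]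
  refine ip_le_of_ip_eq (by positivity) h1.symm (star_ip _ _) ?_
  simpa [smul_smul, hC.ne'] using
    smul_le_smul_of_nonneg_left (hU.ip_bounds hv (R x)).1 (by positivity : (0 : ℝ) ≤ C⁻¹)

theorem IsGramInverse.isDual (hR : IsGramInverse U R) (hU : IsAnalysisOperator v U)
    (hv : HasFrameBounds v C D) : IsDual v (multipliersOf (U.comp R)) :=
  isDual_multipliersOf hv hU (inv_pos.mpr hv.1) (hR.ip_comp_le hU hv) fun x =>
    (hR.adj_eq _).trans (hR.left_inv x)

omit [CompleteSpace X] in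
-- Every `a` splits as `U R U* a` plus an element of `N(U*)`, and `U` is injective with left inverse
-- `R U*`.
theorem IsGramInverse.adj_eq_zero_iff (hR : IsGramInverse U R) :
    {a | U.adjoint a = 0} = {0} ↔ Set.range U = Set.univ := by
  constructor
  · intro h
    refine Set.eq_univ_of_forall fun a => ⟨R (U.adj a), ?_⟩
    have h1 : a - U (R (U.adj a)) ∈ {a | U.adjoint a = 0} := by
      change U.adjoint (a - U (R (U.adj a))) = 0
      rw [Adjointable.map_sub]
      change U.adj a - U.adj (U (R (U.adj a))) = 0
      rw [hR.right_inv, sub_self]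
    rw [h] at h1
    exact (sub_eq_zero.mp h1).symm
  · intro h
    refine Set.eq_singleton_iff_unique_mem.mpr ⟨U.adjoint.map_zero, fun a ha => ?_⟩
    obtain ⟨x, rfl⟩ := Set.range_eq_univ.mp h a
    have h1 : x = 0 := by
      rw [← hR.left_inv x, show U.adj (U x) = 0 from ha, R.map_zero]
    rw [h1, U.map_zero]

theorem IsGramInverse.eq_of_isDual (hR : IsGramInverse U R) (hU : IsAnalysisOperator v U)
    (h : Function.Surjective U.toFun) {w : ℕ → MultiplierModule A X} (hw : IsDual v w) :
    w = multipliersOf (U.comp R) := by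
  obtain ⟨W, hW, hWU⟩ := hw.exists_left_inverse hU
  have h1 : W = U.comp R := Adjointable.ext_of_adj fun a => by
    obtain ⟨x, rfl⟩ := h a
    exact (hWU x).trans ((hR.adj_eq _).trans (hR.left_inv x)).symm
  rw [← h1]
  exact hW.eq_multipliersOf

theorem IsGramInverse.adj_eq_zero_of_unique (hR : IsGramInverse U R)
    (hU : IsAnalysisOperator v U) (hv : HasFrameBounds v C D) (hX : IsFull A X)
    (h : ∀ w, IsDual v w → w = multipliersOf (U.comp R)) : {a | U.adjoint a = 0} = {0} := by
  refine Set.eq_singleton_iff_unique_mem.mpr ⟨U.adjoint.map_zero, fun b hb => ?_⟩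
  refine EllTwo.ext fun n => hX.eq_zero_of_mul_ip fun z x => ?_
  obtain ⟨E, hE, hbE⟩ := exists_ip_rankOne_le b z
  have hC := hv.1
  -- The adjoint of the added term is `a ↦ z ⟨b, a⟩`, which kills the range of `U` because `U* b =
  -- 0`; so `W* U = I` persists.
  let W := (U.comp R).add (rankOne b z)
  have hW : ∀ y, ip A (W y) (W y) ≤ (2 * (C⁻¹ + E)) • ip A y y := fun y => by
    refine (ip_add_self_le _ _).trans ?_
    rw [mul_smul, add_smul]
    exact smul_le_smul_of_nonneg_left (add_le_add (hR.ip_comp_le hU hv y) (hbE y)) zero_le_two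
  have hWU : ∀ y, W.adj (U y) = y := fun y => by
    change R.adj (U.adj (U y)) + z <• ip A b (U y) = y
    have h1 : z <• ip A b (U y) = 0 := ip_eq_of_forall (A := A) fun t => by
      rw [ip_rsmul_right, U.ip_apply_right, show U.adj b = 0 from hb, ← star_ip y, ip_zero_right,
        ip_zero_right, star_zero, mul_zero]
    rw [h1, add_zero, hR.adj_eq, hR.left_inv]
  have h2 := h _ (isDual_multipliersOf hv hU (by positivity) hW hWU)
  have h3 : U (R x) n + b n * ip A z x = U (R x) n :=
    congrArg (fun w : ℕ → MultiplierModule A X => (w n).adj x) h2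
  simpa using h3

theorem IsGramInverse.canonicalDualIsOnlyDual_iff (hR : IsGramInverse U R)
    (hU : IsAnalysisOperator v U) (hv : HasFrameBounds v C D) :
    CanonicalDualIsOnlyDual U v ↔ ∀ w, IsDual v w → w = multipliersOf (U.comp R) := by
  constructor
  · rintro ⟨w, -, -, h⟩ y hy
    rw [h y hy, h _ (hR.isDual hU hv)]
  · exact fun h => ⟨_, hR.isCanonicalDual hU, hR.isDual hU hv, h⟩

omit [CompleteSpace X] in
-- Surjectivity gives `U R U* = I`. Applied to `(a, 0, 0, …)`, which `U*` sends to `u 0 <• a`, its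
-- entry at `0` reads `⟨u 0, R (u 0)⟩ a = a`. This left unit is self-adjoint, hence two-sided.
theorem IsGramInverse.exists_unit (hR : IsGramInverse U R) {u : ℕ → X}
    (hU : IsAnalysisOperator (fun n => MultiplierModule.ofVec A (u n)) U)
    (h : Function.Surjective U.toFun) : ∃ e : A, ∀ a : A, e * a = a ∧ a * e = a := by
  have hleft : ∀ a : A, ip A (u 0) (R (u 0)) * a = a := fun a => by
    have h1 : U.adj (EllTwo.single 0 a) = u 0 <• a :=
      (congrArg (fun w : ℕ → MultiplierModule A X => w 0 a) hU.eq_multipliersOf).symm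
    have h2 : U (R (U.adj (EllTwo.single 0 a))) = EllTwo.single 0 a := by
      obtain ⟨x, hx⟩ := h (EllTwo.single 0 a)
      rw [← hx, hR.left_inv]
    rw [h1, R.map_rsmul] at h2
    rw [← ip_rsmul_right]
    refine (hU _ 0).symm.trans ?_
    rw [h2, EllTwo.single_same]
  have hstar : star (ip A (u 0) (R (u 0))) = ip A (u 0) (R (u 0)) := by
    rw [star_ip, R.ip_adj, hR.adj_eq]
  refine ⟨_, fun a => ⟨hleft a, ?_⟩⟩
  have h1 := congrArg star (hleft (star a))
  rwa [star_mul, star_star, hstar] at h1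

end Duals

end HilbertFrame

/-! ### The theorem and its two consequences -/

theorem theorem4p12
    {A : Type*} [NonUnitalCStarAlgebra A] [PartialOrder A] [StarOrderedRing A]
    {X : Type*} [NormedAddCommGroup X] [NormedSpace ℂ X] [CompleteSpace X]
    [SMul Aᵐᵒᵖ X] [CStarModule Aᵐᵒᵖ X] :
    (∀ v : ℕ → HilbertFrame.MultiplierModule A X, HilbertFrame.IsFrameOrOuterFrame v →
      ∃ U : HilbertFrame.Adjointable A X (HilbertFrame.EllTwo A),
        HilbertFrame.IsAnalysisOperator v U ∧
        (∃ w, HilbertFrame.IsCanonicalDual U v w ∧ HilbertFrame.IsDual v w) ∧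
        ({a | U.adjoint a = 0} = {0} ↔ Set.range U = Set.univ) ∧
        ({a | U.adjoint a = 0} = {0} → HilbertFrame.CanonicalDualIsOnlyDual U v) ∧
        (Set.range U = Set.univ → HilbertFrame.CanonicalDualIsOnlyDual U v) ∧
        (HilbertFrame.IsFull A X →
          (HilbertFrame.CanonicalDualIsOnlyDual U v ↔ {a | U.adjoint a = 0} = {0}) ∧
          (HilbertFrame.CanonicalDualIsOnlyDual U v ↔ Set.range U = Set.univ))) ∧
    (HilbertFrame.IsFull A X →
      (∃ v : ℕ → HilbertFrame.MultiplierModule A X,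
        HilbertFrame.IsFrameOrOuterFrame v ∧ ∃! w, HilbertFrame.IsDual v w) →
      HilbertFrame.UnitarilyEquivalent A X (HilbertFrame.EllTwo A)) ∧
    (HilbertFrame.IsFull A X → HilbertFrame.IsNonUnital A →
      ∀ u : ℕ → X, HilbertFrame.IsFrame A u →
        ∃ y z : ℕ → HilbertFrame.MultiplierModule A X,
          HilbertFrame.IsDual (fun n => HilbertFrame.MultiplierModule.ofVec A (u n)) y ∧
          HilbertFrame.IsDual (fun n => HilbertFrame.MultiplierModule.ofVec A (u n)) z ∧
          y ≠ z) := by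
  open HilbertFrame in
  refine ⟨fun v hv => ?_, fun hX => ?_, fun hX hA u hu => ?_⟩
  · obtain ⟨C, D, hb⟩ := (isFrameOrOuterFrame_iff v).mp hv
    obtain ⟨U, hU⟩ := exists_isAnalysisOperator hb
    obtain ⟨R, hR⟩ := hU.exists_isGramInverse hb
    have hab := hR.adj_eq_zero_iff
    have hc := hR.canonicalDualIsOnlyDual_iff hU hb
    have hbc : Set.range U = Set.univ → CanonicalDualIsOnlyDual U v := fun h =>
      hc.mpr fun w hw => hR.eq_of_isDual hU (Set.range_eq_univ.mp h) hw
    refine ⟨U, hU, ⟨_, hR.isCanonicalDual hU, hR.isDual hU hb⟩, hab, fun h => hbc (hab.mp h), hbc,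
      fun hX => ?_⟩
    have hca : CanonicalDualIsOnlyDual U v → {a | U.adjoint a = 0} = {0} := fun h =>
      hR.adj_eq_zero_of_unique hU hb hX (hc.mp h)
    exact ⟨⟨hca, fun h => hbc (hab.mp h)⟩, ⟨fun h => hab.mp (hca h), hbc⟩⟩
  · rintro ⟨v, hv, w, -, hw⟩
    obtain ⟨C, D, hb⟩ := (isFrameOrOuterFrame_iff v).mp hv
    obtain ⟨U, hU⟩ := exists_isAnalysisOperator hb
    obtain ⟨R, hR⟩ := hU.exists_isGramInverse hb
    have h := hR.adj_eq_zero_of_unique hU hb hX fun y hy =>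
      (hw y hy).trans (hw _ (hR.isDual hU hb)).symm
    exact U.unitarilyEquivalent_of_surjective hb.1 hb.2.1 (fun x => (hU.ip_bounds hb x).1)
      (fun x => (hU.ip_bounds hb x).2) (Set.range_eq_univ.mp (hR.adj_eq_zero_iff.mp h))
  · obtain ⟨C, D, hb⟩ := (isFrameOrOuterFrame_iff fun n => MultiplierModule.ofVec A (u n)).mp
      (Or.inl ⟨u, hu, fun _ => rfl⟩)
    obtain ⟨U, hU⟩ := exists_isAnalysisOperator hb
    obtain ⟨R, hR⟩ := hU.exists_isGramInverse hb
    by_contra hne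
    push Not at hne
    have h := hR.adj_eq_zero_of_unique hU hb hX fun y hy => hne y _ hy (hR.isDual hU hb)
    exact hA (hR.exists_unit hU (Set.range_eq_univ.mp (hR.adj_eq_zero_iff.mp h)))
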